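/- **Theorem (Complexity of is-tree).** The size of a host graph is its total number of nodes and edges. An *input graph* is a finite directed graph (parallel edges and loops allowed) with arbitrary labels (lists of integers and strings), in which every node is marked grey and is not a root and every edge is unmarked. Let \texttt{is-tree} be the GP 2 program \[\texttt{Main = init; Reduce!; Check},\quad \texttt{Reduce = try prune else (push; verify)},\quad \texttt{Check = if \{match, loop\} then fail},\] with the following rules, in which all labels are list variables, so that they match any label, and the nodes that are kept retain their labels. - \texttt{init}: a grey unrooted node of indegree $0$ becomes a blue root. - \texttt{prune}: given an unmarked edge from a blue unrooted node to a blue root with no other incident edges, the edge and its target are deleted and its source becomes a root. - \texttt{push}: given an unmarked edge from a blue root to a grey unrooted node, the source becomes unrooted and the target becomes a blue root. - \texttt{verify}: matches a blue root of indegree less than $2$ and changes nothing. - \texttt{match}: matches a grey unrooted node and changes nothing. - \texttt{loop}: matches a blue root with an unmarked loop and changes nothing. The execution time of the program is that of its compiled code. Matches are found by backtracking search along a search plan, which starts at the roots and follows edges. Each runtime operation takes constant time: fetching the first or next node, root, incoming edge of a node or outgoing edge of a node; testing, setting or clearing the "matched" flag of an item; testing the mark, the rootedness, the stored degrees, the application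 condition or the endpoints of a candidate; making or revoking one elementary modification of the host graph; one control transfer. Reading the input graph and writing the output graph take time linear in the size of the respective graph. Nodes and edges may be traversed in any order. Then, whatever the constants of these operations are, there is a constant $K$, depending only on them, such that for every input graph $G$ of size $s$ (of arbitrary node degrees, possibly empty) every execution of \texttt{is-tree} on $G$ terminates, either with an output graph or by evaluating to fail, in time at most $K\,(s+1)$, including the time for reading $G$ and writing the output graph. That is, \texttt{is-tree} terminates in time linear in the size of its input graph, with no bound on node degrees assumed. -/

import Mathlib

/-! ## Host graphs -/

/-- Marks of host graph nodes. -/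
inductive NodeMark
  | unmarked | red | green | blue | grey
  deriving DecidableEq

/-- Marks of host graph edges. -/
inductive EdgeMark
  | unmarked | red | green | blue | dashed
  deriving DecidableEq

/-- Host graph labels: lists of integers and character strings. -/
abbrev HostLabel := List (ℤ ⊕ String)

/-- Host graphs: finite directed graphs with parallel edges and loops, whose nodes and edges carry
labels and marks and whose nodes may be roots. Items are named by natural numbers; only the values
of the functions on `nodes` and `edges` matter. See `HostGraph.WF` for the incidence condition. -/
structure HostGraph where
  nodes : Finset ℕ
  edges : Finset ℕ
  src : ℕ → ℕ
  tgt : ℕ → ℕ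
  nodeLabel : ℕ → HostLabel
  nodeMark : ℕ → NodeMark
  isRoot : ℕ → Bool
  edgeLabel : ℕ → HostLabel
  edgeMark : ℕ → EdgeMark

namespace HostGraph

/-- Every edge has its source and its target among the nodes. -/
def WF (G : HostGraph) : Prop :=
  ∀ e ∈ G.edges, G.src e ∈ G.nodes ∧ G.tgt e ∈ G.nodes

/-- The size of a host graph: the total number of nodes and edges. -/
def size (G : HostGraph) : ℕ := G.nodes.card + G.edges.card

def indeg (G : HostGraph) (v : ℕ) : ℕ := (G.edges.filter fun e => G.tgt e = v).card

def outdeg (G : HostGraph) (v : ℕ) : ℕ := (G.edges.filter fun e => G.src e = v).card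

/-- Input graphs: arbitrarily labelled host graphs all of whose nodes are grey and unrooted and all
of whose edges are unmarked. -/
structure IsInputGraph (G : HostGraph) : Prop where
  wf : G.WF
  grey : ∀ v ∈ G.nodes, G.nodeMark v = NodeMark.grey
  unrooted : ∀ v ∈ G.nodes, G.isRoot v = false
  unmarked : ∀ e ∈ G.edges, G.edgeMark e = EdgeMark.unmarked

end HostGraph

/-! ## Rules

We represent the rules that do not create nodes, and whose items on the left are labelled with
pairwise distinct variables of type `list`, a numbered node having the same variable on both sides.
Such a variable matches every label, its value is the label of the item matched, and numbered nodes
keep their labels; so the variables of nodes need not be written. -/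

/-- A node of the left-hand side: its mark and rootedness on the left, and, if it is numbered, its
mark and rootedness on the right. `image = none` means that the node is unnumbered, hence deleted. -/
structure RuleNode where
  mark : NodeMark
  root : Bool
  image : Option (NodeMark × Bool)

/-- An edge of the left-hand side, from the node with index `src` to the node with index `tgt`. -/
structure LeftEdge where
  src : ℕ
  tgt : ℕ
  mark : EdgeMark

/-- An edge of the right-hand side. Its label is the variable that labels the left-hand side edge
with index `label`. -/
structure RightEdge where
  src : ℕ
  tgt : ℕ
  mark : EdgeMark
  label : ℕ

/-- Application conditions on the indegree of (the image of) a left-hand side node. -/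
inductive DegCond
  | indegEq (i k : ℕ)
  | indegLt (i k : ℕ)

/-- Conditional rules. Nodes and edges of the left-hand side are referred to by their positions in
the lists. -/
structure Rule where
  nodes : List RuleNode
  leftEdges : List LeftEdge
  rightEdges : List RightEdge
  conds : List DegCond

/-- The condition `d` holds as far as it concerns node `i` when `i` is mapped to `v`. -/
def DegCond.Holds (d : DegCond) (G : HostGraph) (i v : ℕ) : Prop :=
  match d with
  | .indegEq j k => j = i → G.indeg v = k
  | .indegLt j k => j = i → G.indeg v < k

instance (d : DegCond) (G : HostGraph) (i v : ℕ) : Decidable (d.Holds G i v) := by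
  cases d <;> unfold DegCond.Holds <;> infer_instance

namespace Rule

def leftIndeg (r : Rule) (i : ℕ) : ℕ := (r.leftEdges.filter fun e => e.tgt = i).length

def leftOutdeg (r : Rule) (i : ℕ) : ℕ := (r.leftEdges.filter fun e => e.src = i).length

/-- The tests on a host node `v` as a candidate for the left-hand side node `i`: equal marks, equal
rootedness (roots are preserved and reflected), the application conditions on `i`, and degrees. As
matches are injective, for a node that is to be deleted the equality of degrees is the dangling
condition; for a numbered node the degree inequalities are necessary for a match. -/
def NodeOK (r : Rule) (G : HostGraph) (i v : ℕ) : Prop :=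
  match r.nodes[i]? with
  | none => False
  | some p =>
    G.nodeMark v = p.mark ∧ G.isRoot v = p.root ∧ (∀ d ∈ r.conds, d.Holds G i v) ∧
      (if p.image.isNone then G.indeg v = r.leftIndeg i ∧ G.outdeg v = r.leftOutdeg i
        else r.leftIndeg i ≤ G.indeg v ∧ r.leftOutdeg i ≤ G.outdeg v)

instance (r : Rule) (G : HostGraph) (i v : ℕ) : Decidable (r.NodeOK G i v) := by
  unfold Rule.NodeOK
  cases r.nodes[i]? <;> infer_instance

end Rule

/-! ## Search plans -/

/-- The operations of a search plan: look for the image of a root, look for the image of a node,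
look for the image of an edge among the outgoing edges of the image of its source, or among the
incoming edges of the image of its target. An edge operation also determines the image of the
other endpoint. -/
inductive PlanOp
  | root (i : ℕ)
  | node (i : ℕ)
  | outEdge (e : ℕ)
  | inEdge (e : ℕ)

namespace Rule

/-- Extend a plan that covers the nodes `N` and the edges `E` of the left-hand side: follow an edge
at a covered node if there is one, otherwise start at another root, otherwise at another node. -/
def planFrom (r : Rule) : ℕ → List ℕ → List ℕ → List PlanOp
  | 0, _, _ => []
  | fuel + 1, N, E =>
    let edges := r.leftEdges.zipIdx.filter fun p => decide (p.2 ∉ E)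
    let nodes := r.nodes.zipIdx.filter fun p => decide (p.2 ∉ N)
    match edges.find? fun p => decide (p.1.src ∈ N) with
    | some p => .outEdge p.2 :: r.planFrom fuel (p.1.tgt :: N) (p.2 :: E)
    | none =>
      match edges.find? fun p => decide (p.1.tgt ∈ N) with
      | some p => .inEdge p.2 :: r.planFrom fuel (p.1.src :: N) (p.2 :: E)
      | none =>
        match nodes.find? fun p => p.1.root with
        | some p => .root p.2 :: r.planFrom fuel (p.2 :: N) E
        | none =>
          match nodes.head? with
          | some p => .node p.2 :: r.planFrom fuel (p.2 :: N) E
          | none => []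

/-- The search plan of a rule. -/
def plan (r : Rule) : List PlanOp :=
  r.planFrom (r.nodes.length + r.leftEdges.length) [] []

end Rule

/-! ## Matching, with its running time -/

/-- The time taken by the basic operations of the runtime system. The time of each operation is a
constant, apart from `parse` and `print`: reading or writing a graph of size `n` takes time
`parse * (n + 1)` or `print * (n + 1)`. `test` is the time of the checks on one candidate (marks,
rootedness, stored degrees, conditions, endpoints), `update` that of one elementary modification of
the host graph, `undo` that of revoking one, and `control` that of one control transfer. -/
structure OpCosts where
  parse : ℕ
  print : ℕ
  alreadyMatched : ℕ
  clearMatched : ℕ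
  setMatched : ℕ
  firstHostNode : ℕ
  nextHostNode : ℕ
  firstHostRootNode : ℕ
  nextHostRootNode : ℕ
  firstInEdge : ℕ
  nextInEdge : ℕ
  firstOutEdge : ℕ
  nextOutEdge : ℕ
  test : ℕ
  update : ℕ
  undo : ℕ
  control : ℕ

/-- The orders in which the runtime system lists the nodes, the roots, and the outgoing and the
incoming edges of each node of `G`. -/
structure Enumeration (G : HostGraph) where
  nodes : List ℕ
  roots : List ℕ
  outEdges : ℕ → List ℕ
  inEdges : ℕ → List ℕ
  nodes_nodup : nodes.Nodup
  roots_nodup : roots.Nodup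
  outEdges_nodup : ∀ v, (outEdges v).Nodup
  inEdges_nodup : ∀ v, (inEdges v).Nodup
  mem_nodes : ∀ v, v ∈ nodes ↔ v ∈ G.nodes
  mem_roots : ∀ v, v ∈ roots ↔ v ∈ G.nodes ∧ G.isRoot v = true
  mem_outEdges : ∀ v e, e ∈ outEdges v ↔ e ∈ G.edges ∧ G.src e = v
  mem_inEdges : ∀ v e, e ∈ inEdges v ↔ e ∈ G.edges ∧ G.tgt e = v

/-- Partial matches: pairs of a left-hand side item and its image. -/
structure PMatch where
  nodes : List (ℕ × ℕ)
  edges : List (ℕ × ℕ)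

namespace PMatch

def empty : PMatch := ⟨[], []⟩

def node? (m : PMatch) (i : ℕ) : Option ℕ := m.nodes.lookup i

def edge? (m : PMatch) (e : ℕ) : Option ℕ := m.edges.lookup e

def addNode (m : PMatch) (i v : ℕ) : PMatch := { m with nodes := (i, v) :: m.nodes }

def addEdge (m : PMatch) (e h : ℕ) : PMatch := { m with edges := (e, h) :: m.edges }

/-- The host node `v` is flagged as matched. -/
def NodeUsed (m : PMatch) (v : ℕ) : Prop := v ∈ m.nodes.map Prod.snd

/-- The host edge `h` is flagged as matched. -/
def EdgeUsed (m : PMatch) (h : ℕ) : Prop := h ∈ m.edges.map Prod.snd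

instance (m : PMatch) (v : ℕ) : Decidable (m.NodeUsed v) := by
  unfold PMatch.NodeUsed; infer_instance

instance (m : PMatch) (h : ℕ) : Decidable (m.EdgeUsed h) := by
  unfold PMatch.EdgeUsed; infer_instance

end PMatch

/-- Try the candidates of a list one after the other until one succeeds. Fetching the first one
takes time `first`, fetching each further one (or noticing that there is none) takes `next`. -/
def scanList (next : ℕ) (f : ℕ → Option PMatch × ℕ) : List ℕ → Option PMatch × ℕ
  | [] => (none, 0)
  | a :: l =>
    match f a with
    | (some m, t) => (some m, t)
    | (none, t) => ((scanList next f l).1, t + next + (scanList next f l).2)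

def scanAll (first next : ℕ) (f : ℕ → Option PMatch × ℕ) (l : List ℕ) : Option PMatch × ℕ :=
  ((scanList next f l).1, first + (scanList next f l).2)

/-- A candidate has passed its tests: flag it, go on with the continuation whose outcome is `o`, and
clear the flag if the continuation fails. -/
def flagged (c : OpCosts) (o : Option PMatch × ℕ) : Option PMatch × ℕ :=
  (o.1, c.setMatched + o.2 + if o.1.isNone then c.clearMatched else 0)

/-- Consider the host node `v` as the image of node `i`; `k` is the rest of the search. -/
def visitNode (c : OpCosts) (r : Rule) (G : HostGraph) (k : PMatch → Option PMatch × ℕ)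
    (m : PMatch) (i v : ℕ) : Option PMatch × ℕ :=
  if m.NodeUsed v then (none, c.alreadyMatched)
  else if r.NodeOK G i v then
    ((flagged c (k (m.addNode i v))).1,
      c.alreadyMatched + c.test + (flagged c (k (m.addNode i v))).2)
  else (none, c.alreadyMatched + c.test)

/-- The continuation of `visitEdge`: the other endpoint `j` of the edge has to be mapped to `w`. -/
def visitEndpoint (c : OpCosts) (r : Rule) (G : HostGraph) (k : PMatch → Option PMatch × ℕ)
    (m : PMatch) (j w : ℕ) : Option PMatch × ℕ :=
  match m.node? j with
  | some w' => if w = w' then ((k m).1, c.test + (k m).2) else (none, c.test)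
  | none => visitNode c r G k m j w

/-- Consider the host edge `h` as the image of the edge `e` with mark `mk`, where the other endpoint
`j` of `e` corresponds to the other endpoint `w` of `h`. -/
def visitEdge (c : OpCosts) (r : Rule) (G : HostGraph) (k : PMatch → Option PMatch × ℕ)
    (m : PMatch) (e : ℕ) (mk : EdgeMark) (j h w : ℕ) : Option PMatch × ℕ :=
  if m.EdgeUsed h then (none, c.alreadyMatched)
  else if G.edgeMark h = mk then
    ((flagged c (visitEndpoint c r G k (m.addEdge e h) j w)).1,
      c.alreadyMatched + c.test + (flagged c (visitEndpoint c r G k (m.addEdge e h) j w)).2)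
  else (none, c.alreadyMatched + c.test)

/-- Backtracking search along a search plan: the match found, if any, and the time taken. -/
def search (c : OpCosts) (r : Rule) (G : HostGraph) (E : Enumeration G) :
    List PlanOp → PMatch → Option PMatch × ℕ
  | [], m => (some m, 0)
  | .root i :: p, m =>
    scanAll c.firstHostRootNode c.nextHostRootNode
      (visitNode c r G (search c r G E p) m i) E.roots
  | .node i :: p, m =>
    scanAll c.firstHostNode c.nextHostNode
      (visitNode c r G (search c r G E p) m i) E.nodes
  | .outEdge e :: p, m =>
    match r.leftEdges[e]? with
    | none => (none, 0)
    | some le =>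
      match m.node? le.src with
      | none => (none, 0)
      | some v =>
        scanAll c.firstOutEdge c.nextOutEdge
          (fun h => visitEdge c r G (search c r G E p) m e le.mark le.tgt h (G.tgt h))
          (E.outEdges v)
  | .inEdge e :: p, m =>
    match r.leftEdges[e]? with
    | none => (none, 0)
    | some le =>
      match m.node? le.tgt with
      | none => (none, 0)
      | some v =>
        scanAll c.firstInEdge c.nextInEdge
          (fun h => visitEdge c r G (search c r G E p) m e le.mark le.src h (G.src h))
          (E.inEdges v)

/-- Search for a match of one of the rules of a list, in the order of the list. -/
def searchRules (c : OpCosts) (G : HostGraph) (E : Enumeration G) :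
    List Rule → Option (Rule × PMatch) × ℕ
  | [] => (none, 0)
  | r :: rs =>
    match search c r G E r.plan PMatch.empty with
    | (some m, t) => (some (r, m), t)
    | (none, t) => ((searchRules c G E rs).1, t + (searchRules c G E rs).2)

/-! ## Rule application -/

/-- Elementary modifications of a host graph. -/
inductive Update
  | deleteEdge (e : ℕ)
  | deleteNode (v : ℕ)
  | setNode (v : ℕ) (mark : NodeMark) (root : Bool)
  | insertEdge (s t : ℕ) (label : HostLabel) (mark : EdgeMark)

namespace HostGraph

/-- A name that no edge of `G` has. -/
def freshEdge (G : HostGraph) : ℕ := G.edges.sup id + 1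

def update (G : HostGraph) : Update → HostGraph
  | .deleteEdge e => { G with edges := G.edges.erase e }
  | .deleteNode v => { G with nodes := G.nodes.erase v }
  | .setNode v mark root =>
    { G with
      nodeMark := Function.update G.nodeMark v mark
      isRoot := Function.update G.isRoot v root }
  | .insertEdge s t label mark =>
    { G with
      edges := insert G.freshEdge G.edges
      src := Function.update G.src G.freshEdge s
      tgt := Function.update G.tgt G.freshEdge t
      edgeLabel := Function.update G.edgeLabel G.freshEdge label
      edgeMark := Function.update G.edgeMark G.freshEdge mark }

end HostGraph

namespace Rule

/-- What happens to the image `v` of the left-hand side node `i`. -/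
def nodeUpdate (r : Rule) (i v : ℕ) : Update :=
  match r.nodes[i]?.bind RuleNode.image with
  | none => .deleteNode v
  | some (mark, root) => .setNode v mark root

/-- The modifications that replace the match `m` of the left-hand side by the right-hand side: the
matched edges are deleted, unnumbered nodes are deleted, numbered nodes get their new marks and
rootedness, and the edges of the right-hand side are inserted. -/
def updates (r : Rule) (m : PMatch) (G : HostGraph) : List Update :=
  (m.edges.map fun p => .deleteEdge p.2) ++ (m.nodes.map fun p => r.nodeUpdate p.1 p.2) ++
    r.rightEdges.map fun e =>
      .insertEdge ((m.node? e.src).getD 0) ((m.node? e.tgt).getD 0)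
        (G.edgeLabel ((m.edge? e.label).getD 0)) e.mark

/-- The result of applying a rule at a match. -/
def apply (r : Rule) (m : PMatch) (G : HostGraph) : HostGraph :=
  (r.updates m G).foldl HostGraph.update G

end Rule

/-! ## Programs and their execution -/

/-- Command sequences (without `break` and `or`). A call of a rule is the call of a singleton. -/
inductive Com
  | call (rs : List Rule)
  | seq (P Q : Com)
  | ifThenElse (C P Q : Com)
  | tryThenElse (C P Q : Com)
  | alap (P : Com)
  | skip
  | fail

/-- What remains to be done after the current command. The frames of `if`, `try` and `!` record the
host graph and the number of logged modifications at the time of entry. -/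
inductive Frame
  | seq (Q : Com)
  | ifThenElse (G : HostGraph) (log : ℕ) (P Q : Com)
  | tryThenElse (G : HostGraph) (log : ℕ) (P Q : Com)
  | alap (G : HostGraph) (log : ℕ) (P : Com)

/-- The current command is yet to be run, or has resulted in a graph, or has failed. -/
inductive Control
  | run (P : Com)
  | done
  | failed

/-- The states of an execution. In `exec`, `log` is the number of modifications that are logged,
so that they can be revoked. `halted (some G)` means that the graph `G` has been output, `halted
none` that the program has evaluated to fail. -/
inductive State
  | load (G : HostGraph)
  | exec (ctl : Control) (stack : List Frame) (G : HostGraph) (log : ℕ)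
  | halted (result : Option HostGraph)

/-- `Step c P s t s'`: in the execution of the program `P`, the state `s` can be followed by `s'`,
which takes time `t`. Conditions of branchings and bodies of loops are executed in place. Each call
of a rule set may try the rules in any order and may traverse the nodes and edges of the host graph
in any order; the flags of matched items are cleared after a rule has been applied. -/
inductive Step (c : OpCosts) (P : Com) : State → ℕ → State → Prop
  | load (G : HostGraph) :
      Step c P (.load G) (c.parse * (G.size + 1)) (.exec (.run P) [] G 0)
  | callSuccess (rs rs' : List Rule) (K : List Frame) (G : HostGraph) (log : ℕ)
      (E : Enumeration G) (r : Rule) (m : PMatch) (t : ℕ) (hperm : rs'.Perm rs)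
      (hsearch : searchRules c G E rs' = (some (r, m), t)) :
      Step c P (.exec (.run (.call rs)) K G log)
        (c.control + t + c.update * (r.updates m G).length
          + c.clearMatched * (m.nodes.length + m.edges.length))
        (.exec .done K (r.apply m G) (log + (r.updates m G).length))
  | callFail (rs rs' : List Rule) (K : List Frame) (G : HostGraph) (log : ℕ)
      (E : Enumeration G) (t : ℕ) (hperm : rs'.Perm rs)
      (hsearch : searchRules c G E rs' = (none, t)) :
      Step c P (.exec (.run (.call rs)) K G log) (c.control + t) (.exec .failed K G log)
  | skip (K : List Frame) (G : HostGraph) (log : ℕ) :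
      Step c P (.exec (.run .skip) K G log) c.control (.exec .done K G log)
  | fail (K : List Frame) (G : HostGraph) (log : ℕ) :
      Step c P (.exec (.run .fail) K G log) c.control (.exec .failed K G log)
  | seqEnter (A B : Com) (K : List Frame) (G : HostGraph) (log : ℕ) :
      Step c P (.exec (.run (.seq A B)) K G log) c.control (.exec (.run A) (.seq B :: K) G log)
  | seqDone (B : Com) (K : List Frame) (G : HostGraph) (log : ℕ) :
      Step c P (.exec .done (.seq B :: K) G log) c.control (.exec (.run B) K G log)
  | seqFailed (B : Com) (K : List Frame) (G : HostGraph) (log : ℕ) :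
      Step c P (.exec .failed (.seq B :: K) G log) c.control (.exec .failed K G log)
  | ifEnter (C A B : Com) (K : List Frame) (G : HostGraph) (log : ℕ) :
      Step c P (.exec (.run (.ifThenElse C A B)) K G log) c.control
        (.exec (.run C) (.ifThenElse G log A B :: K) G log)
  | ifDone (G₀ : HostGraph) (log₀ : ℕ) (A B : Com) (K : List Frame) (G : HostGraph) (log : ℕ) :
      Step c P (.exec .done (.ifThenElse G₀ log₀ A B :: K) G log)
        (c.control + c.undo * (log - log₀)) (.exec (.run A) K G₀ log₀)
  | ifFailed (G₀ : HostGraph) (log₀ : ℕ) (A B : Com) (K : List Frame) (G : HostGraph) (log : ℕ) :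
      Step c P (.exec .failed (.ifThenElse G₀ log₀ A B :: K) G log)
        (c.control + c.undo * (log - log₀)) (.exec (.run B) K G₀ log₀)
  | tryEnter (C A B : Com) (K : List Frame) (G : HostGraph) (log : ℕ) :
      Step c P (.exec (.run (.tryThenElse C A B)) K G log) c.control
        (.exec (.run C) (.tryThenElse G log A B :: K) G log)
  | tryDone (G₀ : HostGraph) (log₀ : ℕ) (A B : Com) (K : List Frame) (G : HostGraph) (log : ℕ) :
      Step c P (.exec .done (.tryThenElse G₀ log₀ A B :: K) G log) c.control
        (.exec (.run A) K G log)
  | tryFailed (G₀ : HostGraph) (log₀ : ℕ) (A B : Com) (K : List Frame) (G : HostGraph) (log : ℕ) :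
      Step c P (.exec .failed (.tryThenElse G₀ log₀ A B :: K) G log)
        (c.control + c.undo * (log - log₀)) (.exec (.run B) K G₀ log₀)
  | alapEnter (A : Com) (K : List Frame) (G : HostGraph) (log : ℕ) :
      Step c P (.exec (.run (.alap A)) K G log) c.control
        (.exec (.run A) (.alap G log A :: K) G log)
  | alapDone (G₀ : HostGraph) (log₀ : ℕ) (A : Com) (K : List Frame) (G : HostGraph) (log : ℕ) :
      Step c P (.exec .done (.alap G₀ log₀ A :: K) G log) c.control
        (.exec (.run (.alap A)) K G log)
  | alapFailed (G₀ : HostGraph) (log₀ : ℕ) (A : Com) (K : List Frame) (G : HostGraph) (log : ℕ) :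
      Step c P (.exec .failed (.alap G₀ log₀ A :: K) G log)
        (c.control + c.undo * (log - log₀)) (.exec .done K G₀ log₀)
  | output (G : HostGraph) (log : ℕ) :
      Step c P (.exec .done [] G log) (c.print * (G.size + 1)) (.halted (some G))
  | abort (G : HostGraph) (log : ℕ) :
      Step c P (.exec .failed [] G log) c.control (.halted none)

/-- `Reaches c P s t s'`: some execution of `P` leads from `s` to `s'` in total time `t`. -/
inductive Reaches (c : OpCosts) (P : Com) : State → ℕ → State → Prop
  | refl (s : State) : Reaches c P s 0 s
  | tail {s₁ s₂ s₃ : State} {t u : ℕ} :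
      Reaches c P s₁ t s₂ → Step c P s₂ u s₃ → Reaches c P s₁ (t + u) s₃

/-- On the input graph `G`, every execution of `P` terminates within time `T`: there is no infinite
execution, an execution can only stop in a halted state, and no execution takes more time than
`T`, including the time for reading `G` and for writing the output graph. -/
structure TerminatesWithin (c : OpCosts) (P : Com) (G : HostGraph) (T : ℕ) : Prop where
  not_diverges : ¬ ∃ s : ℕ → State, s 0 = .load G ∧ ∀ n, ∃ t, Step c P (s n) t (s (n + 1))
  not_stuck : ∀ (s : State) (t : ℕ), Reaches c P (.load G) t s →
    (∃ res, s = .halted res) ∨ ∃ u s', Step c P s u s'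
  time_le : ∀ (s : State) (t : ℕ), Reaches c P (.load G) t s → t ≤ T

/-! ## The program `is-tree` -/

namespace IsTree

/-- A grey unrooted node of indegree 0 becomes a blue root. -/
def initRule : Rule where
  nodes := [⟨.grey, false, some (.blue, true)⟩]
  leftEdges := []
  rightEdges := []
  conds := [.indegEq 0 0]

/-- A blue root (unnumbered, so deleted) is removed with the unmarked edge to it from a blue unrooted
node, which becomes a root. -/
def pruneRule : Rule where
  nodes := [⟨.blue, false, some (.blue, true)⟩, ⟨.blue, true, none⟩]
  leftEdges := [⟨0, 1, .unmarked⟩]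
  rightEdges := []
  conds := []

/-- The root moves from a blue node along an unmarked edge to a grey node, which becomes blue. -/
def pushRule : Rule where
  nodes := [⟨.blue, true, some (.blue, false)⟩, ⟨.grey, false, some (.blue, true)⟩]
  leftEdges := [⟨0, 1, .unmarked⟩]
  rightEdges := [⟨0, 1, .unmarked, 0⟩]
  conds := []

/-- There is a blue root of indegree less than 2. -/
def verifyRule : Rule where
  nodes := [⟨.blue, true, some (.blue, true)⟩]
  leftEdges := []
  rightEdges := []
  conds := [.indegLt 0 2]

/-- There is a grey unrooted node. -/
def matchRule : Rule where
  nodes := [⟨.grey, false, some (.grey, false)⟩]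
  leftEdges := []
  rightEdges := []
  conds := []

/-- There is a blue root with an unmarked loop. -/
def loopRule : Rule where
  nodes := [⟨.blue, true, some (.blue, true)⟩]
  leftEdges := [⟨0, 0, .unmarked⟩]
  rightEdges := [⟨0, 0, .unmarked, 0⟩]
  conds := []

/-- `Reduce = try prune else (push; verify)` -/
def reduce : Com :=
  .tryThenElse (.call [pruneRule]) .skip (.seq (.call [pushRule]) (.call [verifyRule]))

/-- `Check = if {match, loop} then fail` -/
def check : Com := .ifThenElse (.call [matchRule, loopRule]) .fail .skip

/-- `Main = init; Reduce!; Check` -/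
def main : Com := .seq (.call [initRule]) (.seq (.alap reduce) check)

end IsTree

/-! ## Bounding the time of all executions -/

/-! The program is a depth-first search that walks down from a node of indegree 0, deletes finished
leaves and stops at the first sign that the graph is not a tree. The bound rests on two facts: an
iteration of `Reduce!` takes constant time, whatever the node degrees, and there are linearly many
iterations.

Constant time needs an invariant, `IsDFS`: the blue nodes form a path `l` headed by the only root,
and an edge can enter the path only from the preceding path node. Hence no edge leaves the root for
a blue node, so the first outgoing edge that `push` looks at already gives a match (`push_time_le`).
For `prune`, the dangling condition is tested on the root before any edge is fetched, and only a
root of indegree 1 gets past it (`prune_time_le`). `verify` inspects the only root. Its test is also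
what preserves the invariant: after a push it leaves the edge just followed as the only one entering
the new root (`isDFS_push`).

For the number of iterations, take the potential `2 * |V| - |l|`. A prune lowers both `|V|` and
`|l|` by one, a push raises `|l|` by one, so each lowers the potential by one. An iteration that
fails ends the loop and restores the graph it started from, which satisfies the invariant
(`within_reduce`). The searches of `init` and `Check` may be linear, since each is run once.

The predicate `Within` expresses termination, absence of stuck states and the time bound at once,
and is proved backwards, from what remains to be done. All costs are majorised by multiples of
`OpCosts.total`. -/

namespace OpCosts

/-- The sum of all the constants. -/
def total (c : OpCosts) : ℕ :=
  c.parse + c.print + c.alreadyMatched + c.clearMatched + c.setMatched + c.firstHostNode +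
    c.nextHostNode + c.firstHostRootNode + c.nextHostRootNode + c.firstInEdge + c.nextInEdge +
    c.firstOutEdge + c.nextOutEdge + c.test + c.update + c.undo + c.control

end OpCosts

/-- Every execution of `P` from the given state terminates within the given time. -/
inductive Within (c : OpCosts) (P : Com) : State → ℕ → Prop
  | halted (res : Option HostGraph) (T : ℕ) : Within c P (.halted res) T
  | step {s : State} {T : ℕ} (progress : ∃ u s', Step c P s u s')
      (time : ∀ u s', Step c P s u s' → u ≤ T)
      (next : ∀ u s', Step c P s u s' → Within c P s' (T - u)) : Within c P s T

namespace Within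

variable {c : OpCosts} {P : Com}

theorem mono {s : State} {T T' : ℕ} (h : Within c P s T) (hT : T ≤ T') : Within c P s T' := by
  induction h generalizing T' with
  | halted res T => exact .halted res T'
  | step progress time next ih =>
    exact .step progress (fun u s' hs => (time u s' hs).trans hT)
      (fun u s' hs => ih u s' hs (Nat.sub_le_sub_right hT u))

theorem of_step {s : State} {T : ℕ} (progress : ∃ u s', Step c P s u s')
    (next : ∀ u s', Step c P s u s' → ∃ T', u + T' ≤ T ∧ Within c P s' T') : Within c P s T := by
  refine .step progress (fun u s' hs => ?_) (fun u s' hs => ?_)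
  · obtain ⟨T', hT', -⟩ := next u s' hs
    omega
  · obtain ⟨T', hT', hw⟩ := next u s' hs
    exact hw.mono (by omega)

/-- Each step spends part of the budget. As its cost is at most what is left, the truncated
subtraction is a true one. -/
theorem of_reaches {s s' : State} {t T : ℕ} (h : Within c P s T) (hr : Reaches c P s t s') :
    t ≤ T ∧ Within c P s' (T - t) := by
  induction hr with
  | refl => exact ⟨Nat.zero_le _, h⟩
  | tail hr hs ih =>
    obtain ⟨ht, hw⟩ := ih
    cases hw with
    | halted => cases hs
    | step progress time next =>
      have hu := time _ _ hs
      refine ⟨by omega, ?_⟩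
      rw [Nat.sub_add_eq]
      exact next _ _ hs

/-- Steps may cost 0, so the time bound alone does not exclude infinite executions; the
well-foundedness of the inductive predicate does. -/
theorem not_diverges {s : State} {T : ℕ} (h : Within c P s T) :
    ¬ ∃ f : ℕ → State, f 0 = s ∧ ∀ n, ∃ t, Step c P (f n) t (f (n + 1)) := by
  induction h with
  | halted res T =>
    rintro ⟨f, h0, hf⟩
    obtain ⟨t, ht⟩ := hf 0
    rw [h0] at ht
    cases ht
  | step progress time next ih =>
    rintro ⟨f, rfl, hf⟩
    obtain ⟨t, ht⟩ := hf 0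
    exact ih t _ ht ⟨fun n => f (n + 1), rfl, fun n => hf (n + 1)⟩

theorem terminatesWithin {G : HostGraph} {T : ℕ} (h : Within c P (.load G) T) :
    TerminatesWithin c P G T where
  not_diverges := h.not_diverges
  not_stuck s t hr := by
    cases (h.of_reaches hr).2 with
    | halted res => exact .inl ⟨res, rfl⟩
    | step progress => exact .inr progress
  time_le s t hr := (h.of_reaches hr).1

end Within

/-! ## Single steps -/

theorem OpCosts.control_le (c : OpCosts) : c.control ≤ c.total := by
  unfold OpCosts.total; omega

theorem OpCosts.control_add_undo_mul_le (c : OpCosts) (n : ℕ) :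
    c.control + c.undo * n ≤ c.total * (n + 1) := by
  have : c.control + c.undo ≤ c.total := by unfold OpCosts.total; omega
  nlinarith

namespace Within

variable {c : OpCosts} {P : Com} {K : List Frame} {G : HostGraph} {log T : ℕ}

theorem load (h : Within c P (.exec (.run P) [] G 0) T) :
    Within c P (.load G) (c.total * (G.size + 1) + T) := by
  refine of_step ⟨_, _, .load G⟩ fun u s' hs => ?_
  cases hs
  exact ⟨T, Nat.add_le_add_right
    (Nat.mul_le_mul_right _ (by unfold OpCosts.total; omega)) _, h⟩

theorem skip (h : Within c P (.exec .done K G log) T) :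
    Within c P (.exec (.run .skip) K G log) (c.total + T) := by
  refine of_step ⟨_, _, .skip K G log⟩ fun u s' hs => ?_
  cases hs
  exact ⟨T, Nat.add_le_add_right c.control_le _, h⟩

theorem fail (h : Within c P (.exec .failed K G log) T) :
    Within c P (.exec (.run .fail) K G log) (c.total + T) := by
  refine of_step ⟨_, _, .fail K G log⟩ fun u s' hs => ?_
  cases hs
  exact ⟨T, Nat.add_le_add_right c.control_le _, h⟩

theorem seqEnter {A B : Com} (h : Within c P (.exec (.run A) (.seq B :: K) G log) T) :
    Within c P (.exec (.run (.seq A B)) K G log) (c.total + T) := by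
  refine of_step ⟨_, _, .seqEnter A B K G log⟩ fun u s' hs => ?_
  cases hs
  exact ⟨T, Nat.add_le_add_right c.control_le _, h⟩

theorem seqDone {B : Com} (h : Within c P (.exec (.run B) K G log) T) :
    Within c P (.exec .done (.seq B :: K) G log) (c.total + T) := by
  refine of_step ⟨_, _, .seqDone B K G log⟩ fun u s' hs => ?_
  cases hs
  exact ⟨T, Nat.add_le_add_right c.control_le _, h⟩

theorem seqFailed {B : Com} (h : Within c P (.exec .failed K G log) T) :
    Within c P (.exec .failed (.seq B :: K) G log) (c.total + T) := by
  refine of_step ⟨_, _, .seqFailed B K G log⟩ fun u s' hs => ?_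
  cases hs
  exact ⟨T, Nat.add_le_add_right c.control_le _, h⟩

theorem ifEnter {C A B : Com}
    (h : Within c P (.exec (.run C) (.ifThenElse G log A B :: K) G log) T) :
    Within c P (.exec (.run (.ifThenElse C A B)) K G log) (c.total + T) := by
  refine of_step ⟨_, _, .ifEnter C A B K G log⟩ fun u s' hs => ?_
  cases hs
  exact ⟨T, Nat.add_le_add_right c.control_le _, h⟩

theorem ifDone {G₀ : HostGraph} {log₀ : ℕ} {A B : Com}
    (h : Within c P (.exec (.run A) K G₀ log₀) T) :
    Within c P (.exec .done (.ifThenElse G₀ log₀ A B :: K) G log)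
      (c.total * (log - log₀ + 1) + T) := by
  refine of_step ⟨_, _, .ifDone G₀ log₀ A B K G log⟩ fun u s' hs => ?_
  cases hs
  exact ⟨T, Nat.add_le_add_right (c.control_add_undo_mul_le _) _, h⟩

theorem ifFailed {G₀ : HostGraph} {log₀ : ℕ} {A B : Com}
    (h : Within c P (.exec (.run B) K G₀ log₀) T) :
    Within c P (.exec .failed (.ifThenElse G₀ log₀ A B :: K) G log)
      (c.total * (log - log₀ + 1) + T) := by
  refine of_step ⟨_, _, .ifFailed G₀ log₀ A B K G log⟩ fun u s' hs => ?_
  cases hs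
  exact ⟨T, Nat.add_le_add_right (c.control_add_undo_mul_le _) _, h⟩

theorem tryEnter {C A B : Com}
    (h : Within c P (.exec (.run C) (.tryThenElse G log A B :: K) G log) T) :
    Within c P (.exec (.run (.tryThenElse C A B)) K G log) (c.total + T) := by
  refine of_step ⟨_, _, .tryEnter C A B K G log⟩ fun u s' hs => ?_
  cases hs
  exact ⟨T, Nat.add_le_add_right c.control_le _, h⟩

theorem tryDone {G₀ : HostGraph} {log₀ : ℕ} {A B : Com}
    (h : Within c P (.exec (.run A) K G log) T) :
    Within c P (.exec .done (.tryThenElse G₀ log₀ A B :: K) G log) (c.total + T) := by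
  refine of_step ⟨_, _, .tryDone G₀ log₀ A B K G log⟩ fun u s' hs => ?_
  cases hs
  exact ⟨T, Nat.add_le_add_right c.control_le _, h⟩

theorem tryFailed {G₀ : HostGraph} {log₀ : ℕ} {A B : Com}
    (h : Within c P (.exec (.run B) K G₀ log₀) T) :
    Within c P (.exec .failed (.tryThenElse G₀ log₀ A B :: K) G log)
      (c.total * (log - log₀ + 1) + T) := by
  refine of_step ⟨_, _, .tryFailed G₀ log₀ A B K G log⟩ fun u s' hs => ?_
  cases hs
  exact ⟨T, Nat.add_le_add_right (c.control_add_undo_mul_le _) _, h⟩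

theorem alapEnter {A : Com} (h : Within c P (.exec (.run A) (.alap G log A :: K) G log) T) :
    Within c P (.exec (.run (.alap A)) K G log) (c.total + T) := by
  refine of_step ⟨_, _, .alapEnter A K G log⟩ fun u s' hs => ?_
  cases hs
  exact ⟨T, Nat.add_le_add_right c.control_le _, h⟩

theorem alapDone {G₀ : HostGraph} {log₀ : ℕ} {A : Com}
    (h : Within c P (.exec (.run (.alap A)) K G log) T) :
    Within c P (.exec .done (.alap G₀ log₀ A :: K) G log) (c.total + T) := by
  refine of_step ⟨_, _, .alapDone G₀ log₀ A K G log⟩ fun u s' hs => ?_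
  cases hs
  exact ⟨T, Nat.add_le_add_right c.control_le _, h⟩

theorem alapFailed {G₀ : HostGraph} {log₀ : ℕ} {A : Com}
    (h : Within c P (.exec .done K G₀ log₀) T) :
    Within c P (.exec .failed (.alap G₀ log₀ A :: K) G log)
      (c.total * (log - log₀ + 1) + T) := by
  refine of_step ⟨_, _, .alapFailed G₀ log₀ A K G log⟩ fun u s' hs => ?_
  cases hs
  exact ⟨T, Nat.add_le_add_right (c.control_add_undo_mul_le _) _, h⟩

theorem output : Within c P (.exec .done [] G log) (c.total * (G.size + 1)) := by
  refine of_step ⟨_, _, .output G log⟩ fun u s' hs => ?_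
  cases hs
  exact ⟨0, Nat.mul_le_mul_right _ (by unfold OpCosts.total; omega), .halted _ _⟩

theorem abort : Within c P (.exec .failed [] G log) c.total := by
  refine of_step ⟨_, _, .abort G log⟩ fun u s' hs => ?_
  cases hs
  exact ⟨0, c.control_le, .halted _ _⟩

end Within

/-! ## Rule calls -/

theorem searchRules_time_le {c : OpCosts} {G : HostGraph} {E : Enumeration G} {B : ℕ}
    (rs : List Rule) (h : ∀ r ∈ rs, (search c r G E r.plan PMatch.empty).2 ≤ B) :
    (searchRules c G E rs).2 ≤ rs.length * B := by
  induction rs with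
  | nil => simp [searchRules]
  | cons r rs ih =>
    have h1 := h r (by simp)
    have h2 := ih fun r' hr' => h r' (by simp [hr'])
    unfold searchRules
    rw [List.length_cons, Nat.succ_mul]
    split <;> rename_i heq <;> rw [heq] at h1 <;> dsimp only at h1 ⊢ <;> omega

theorem searchRules_eq_some {c : OpCosts} {G : HostGraph} {E : Enumeration G} {r : Rule}
    {m : PMatch} (rs : List Rule) (h : (searchRules c G E rs).1 = some (r, m)) :
    r ∈ rs ∧ (search c r G E r.plan PMatch.empty).1 = some m := by
  induction rs with
  | nil => simp [searchRules] at h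
  | cons r' rs ih =>
    unfold searchRules at h
    split at h
    · rename_i heq
      simp only [Option.some.injEq, Prod.mk.injEq] at h
      obtain ⟨rfl, rfl⟩ := h
      simp [heq]
    · exact ⟨List.mem_cons_of_mem _ (ih h).1, (ih h).2⟩

/-- Some order of traversal. -/
noncomputable def Enumeration.default (G : HostGraph) : Enumeration G where
  nodes := G.nodes.toList
  roots := (G.nodes.filter fun v => G.isRoot v = true).toList
  outEdges v := (G.edges.filter fun e => G.src e = v).toList
  inEdges v := (G.edges.filter fun e => G.tgt e = v).toList
  nodes_nodup := Finset.nodup_toList _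
  roots_nodup := Finset.nodup_toList _
  outEdges_nodup _ := Finset.nodup_toList _
  inEdges_nodup _ := Finset.nodup_toList _
  mem_nodes := by simp
  mem_roots := by simp
  mem_outEdges := by simp
  mem_inEdges := by simp

/-- Here `B` bounds the search for one rule, and `n` bounds both the modifications to be made and
the flags to be cleared. The rule order and the enumeration are chosen by the execution, hence the
quantification over all of them. -/
theorem Within.call {c : OpCosts} {P : Com} {K : List Frame} {G : HostGraph} {log T B n : ℕ}
    {rs : List Rule}
    (htime : ∀ E : Enumeration G, ∀ r ∈ rs, (search c r G E r.plan PMatch.empty).2 ≤ B)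
    (hsucc : ∀ E : Enumeration G, ∀ r ∈ rs, ∀ m,
      (search c r G E r.plan PMatch.empty).1 = some m →
      m.nodes.length + m.edges.length ≤ n ∧ (r.updates m G).length ≤ n ∧
      Within c P (.exec .done K (r.apply m G) (log + (r.updates m G).length)) T)
    (hfail : Within c P (.exec .failed K G log) T) :
    Within c P (.exec (.run (.call rs)) K G log) (rs.length * B + c.total * (n + 1) + T) := by
  refine of_step ?_ fun u s' hs => ?_
  -- The search is a total function, so for any one enumeration it yields a successful or a failing
  -- step.
  · rcases hq : searchRules c G (Enumeration.default G) rs with ⟨_ | ⟨r, m⟩, t⟩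
    · exact ⟨_, _, .callFail rs rs K G log _ t (.refl _) hq⟩
    · exact ⟨_, _, .callSuccess rs rs K G log _ r m t (.refl _) hq⟩
  · have key : c.control + c.update * n + c.clearMatched * n ≤ c.total * (n + 1) := by
      have : c.control + c.update + c.clearMatched ≤ c.total := by unfold OpCosts.total; omega
      nlinarith
    cases hs with
    | callSuccess _ rs' _ _ _ E r m t hperm hsearch =>
      have ht := searchRules_time_le (c := c) (E := E) rs'
        fun r' hr' => htime E r' (hperm.mem_iff.1 hr')
      rw [hsearch, hperm.length_eq] at ht
      obtain ⟨hr, hm⟩ := searchRules_eq_some (c := c) (E := E) rs' (by rw [hsearch])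
      obtain ⟨h1, h2, h3⟩ := hsucc E r (hperm.mem_iff.1 hr) m hm
      refine ⟨T, ?_, h3⟩
      have h4 := Nat.mul_le_mul_left c.update h2
      have h5 := Nat.mul_le_mul_left c.clearMatched h1
      dsimp only at ht
      omega
    | callFail _ rs' _ _ _ E t hperm hsearch =>
      have ht := searchRules_time_le (c := c) (E := E) rs'
        fun r' hr' => htime E r' (hperm.mem_iff.1 hr')
      rw [hsearch, hperm.length_eq] at ht
      refine ⟨T, ?_, hfail⟩
      dsimp only at ht
      omega

/-! ## Time and outcome of searches -/

section Scan

variable {first next B : ℕ} {f : ℕ → Option PMatch × ℕ} {l : List ℕ}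

theorem scanAll_time_le (h : ∀ a ∈ l, (f a).2 ≤ B) :
    (scanAll first next f l).2 ≤ first + l.length * (B + next) := by
  refine Nat.add_le_add_left ?_ _
  induction l with
  | nil => simp [scanList]
  | cons a l ih =>
    have h1 := h a (by simp)
    have h2 := ih fun b hb => h b (by simp [hb])
    unfold scanList
    rw [List.length_cons, Nat.succ_mul]
    split <;> rename_i heq <;> rw [heq] at h1 <;> dsimp only at h1 ⊢ <;> omega

/-- The scan stops at its first candidate, so the length of the list does not enter. This removes
the outdegree from the cost of `push`. -/
theorem scanAll_time_le_of_isSome (h : ∀ a ∈ l, (f a).1.isSome ∧ (f a).2 ≤ B) :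
    (scanAll first next f l).2 ≤ first + B := by
  refine Nat.add_le_add_left ?_ _
  cases l with
  | nil => simp [scanList]
  | cons a l =>
    have h1 := h a (by simp)
    unfold scanList
    split <;> rename_i heq <;> rw [heq] at h1
    · exact h1.2
    · simp at h1

theorem exists_of_scanAll_eq_some {m : PMatch} (h : (scanAll first next f l).1 = some m) :
    ∃ a ∈ l, (f a).1 = some m := by
  unfold scanAll at h
  dsimp only at h
  induction l with
  | nil => simp [scanList] at h
  | cons a l ih =>
    unfold scanList at h
    split at h
    · rename_i heq
      exact ⟨a, by simp, by rw [heq]; exact h⟩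
    · obtain ⟨b, hb, hb'⟩ := ih h
      exact ⟨b, by simp [hb], hb'⟩

end Scan

section Visit

variable {c : OpCosts} {r : Rule} {G : HostGraph} {k : PMatch → Option PMatch × ℕ} {m m' : PMatch}
  {e i j v w h B : ℕ} {mk : EdgeMark}

theorem flagged_time_le (o : Option PMatch × ℕ) :
    (flagged c o).2 ≤ c.setMatched + o.2 + c.clearMatched := by
  unfold flagged
  dsimp only
  split <;> omega

/-- The continuation runs only if the tests succeed, so its bound may use them; `prune` depends on
this. -/
theorem visitNode_time_le (hk : r.NodeOK G i v → (k (m.addNode i v)).2 ≤ B) :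
    (visitNode c r G k m i v).2 ≤ c.total + B := by
  have hf := flagged_time_le (c := c) (k (m.addNode i v))
  have : c.alreadyMatched + c.test + c.setMatched + c.clearMatched ≤ c.total := by
    unfold OpCosts.total; omega
  unfold visitNode
  split_ifs with h1 h2
  · dsimp only; omega
  · have := hk h2
    dsimp only; omega
  · dsimp only; omega

theorem visitNode_eq_some (hv : (visitNode c r G k m i v).1 = some m') :
    ¬ m.NodeUsed v ∧ r.NodeOK G i v ∧ (k (m.addNode i v)).1 = some m' := by
  unfold visitNode at hv
  split_ifs at hv with h1 h2
  exact ⟨h1, h2, hv⟩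

theorem visitNode_isSome (h1 : ¬ m.NodeUsed v) (h2 : r.NodeOK G i v)
    (h3 : (k (m.addNode i v)).1.isSome) : (visitNode c r G k m i v).1.isSome := by
  unfold visitNode
  rw [if_neg h1, if_pos h2]
  exact h3

theorem visitEndpoint_time_le (hk : ∀ m, (k m).2 ≤ B) :
    (visitEndpoint c r G k m j w).2 ≤ c.total + B := by
  have : c.test ≤ c.total := by unfold OpCosts.total; omega
  unfold visitEndpoint
  split
  · have := hk m
    split_ifs <;> dsimp only <;> omega
  · exact visitNode_time_le fun _ => hk _

theorem visitEdge_time_le (hk : ∀ m, (k m).2 ≤ B) :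
    (visitEdge c r G k m e mk j h w).2 ≤ c.total + (c.total + B) := by
  have hf := flagged_time_le (c := c) (visitEndpoint c r G k (m.addEdge e h) j w)
  have hv := visitEndpoint_time_le (c := c) (r := r) (G := G) (m := m.addEdge e h) (j := j)
    (w := w) hk
  have : c.alreadyMatched + c.test + c.setMatched + c.clearMatched ≤ c.total := by
    unfold OpCosts.total; omega
  unfold visitEdge
  split_ifs <;> dsimp only <;> omega

theorem visitEdge_eq_some (hv : (visitEdge c r G k m e mk j h w).1 = some m') :
    ¬ m.EdgeUsed h ∧ G.edgeMark h = mk ∧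
      (visitEndpoint c r G k (m.addEdge e h) j w).1 = some m' := by
  unfold visitEdge at hv
  split_ifs at hv with h1 h2
  exact ⟨h1, h2, hv⟩

theorem visitEdge_isSome (h1 : ¬ m.EdgeUsed h) (h2 : G.edgeMark h = mk)
    (h3 : (visitEndpoint c r G k (m.addEdge e h) j w).1.isSome) :
    (visitEdge c r G k m e mk j h w).1.isSome := by
  unfold visitEdge
  rw [if_neg h1, if_pos h2]
  exact h3

theorem visitEndpoint_of_none (hj : m.node? j = none) :
    visitEndpoint c r G k m j w = visitNode c r G k m j w := by
  unfold visitEndpoint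
  rw [hj]

theorem visitEndpoint_eq_some_of_some (hj : m.node? j = some v)
    (hv : (visitEndpoint c r G k m j w).1 = some m') : w = v ∧ (k m).1 = some m' := by
  unfold visitEndpoint at hv
  rw [hj] at hv
  dsimp only at hv
  split_ifs at hv with h1
  exact ⟨h1, hv⟩

end Visit

/-! ### Lengths of the traversal lists -/

namespace Enumeration

variable {G : HostGraph} (E : Enumeration G)

theorem length_nodes : E.nodes.length = G.nodes.card := by
  rw [← List.toFinset_card_of_nodup E.nodes_nodup]
  congr 1
  ext v
  simp [E.mem_nodes]

theorem length_inEdges (v : ℕ) : (E.inEdges v).length = G.indeg v := by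
  rw [← List.toFinset_card_of_nodup (E.inEdges_nodup v)]
  unfold HostGraph.indeg
  congr 1
  ext e
  simp [E.mem_inEdges]

theorem length_outEdges (v : ℕ) : (E.outEdges v).length = G.outdeg v := by
  rw [← List.toFinset_card_of_nodup (E.outEdges_nodup v)]
  unfold HostGraph.outdeg
  congr 1
  ext e
  simp [E.mem_outEdges]

theorem length_roots_le_one
    (h : ∀ v ∈ G.nodes, ∀ w ∈ G.nodes, G.isRoot v = true → G.isRoot w = true → v = w) :
    E.roots.length ≤ 1 := by
  rw [← List.toFinset_card_of_nodup E.roots_nodup, Finset.card_le_one]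
  intro v hv w hw
  rw [List.mem_toFinset, E.mem_roots] at hv hw
  exact h v hv.1 w hw.1 hv.2 hw.2

end Enumeration

theorem HostGraph.outdeg_le_card (G : HostGraph) (v : ℕ) : G.outdeg v ≤ G.edges.card :=
  Finset.card_filter_le _ _

/-! ### Searches for the six rules of `is-tree` -/

namespace IsTree

variable {c : OpCosts} {G : HostGraph} (E : Enumeration G) {r : Rule} {m : PMatch}

/-- There is at most one root. -/
def OneRoot (G : HostGraph) : Prop :=
  ∀ v ∈ G.nodes, ∀ w ∈ G.nodes, G.isRoot v = true → G.isRoot w = true → v = w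

theorem search_node_time_le :
    (search c r G E [.node 0] PMatch.empty).2 ≤ c.total * (2 * G.nodes.card + 1) := by
  have h := scanAll_time_le (first := c.firstHostNode) (next := c.nextHostNode) (l := E.nodes)
    (f := visitNode c r G (search c r G E []) PMatch.empty 0) (B := c.total) fun a _ =>
      visitNode_time_le (B := 0) fun _ => le_rfl
  rw [E.length_nodes] at h
  have h1 : c.firstHostNode ≤ c.total := by unfold OpCosts.total; omega
  have h2 : c.nextHostNode ≤ c.total := by unfold OpCosts.total; omega
  have h3 := Nat.mul_le_mul_left G.nodes.card h2
  unfold search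
  linarith

theorem search_node_eq_some (h : (search c r G E [.node 0] PMatch.empty).1 = some m) :
    ∃ v ∈ G.nodes, r.NodeOK G 0 v ∧ m = ⟨[(0, v)], []⟩ := by
  unfold search at h
  obtain ⟨v, hv, hm⟩ := exists_of_scanAll_eq_some h
  obtain ⟨-, h2, h3⟩ := visitNode_eq_some hm
  rw [E.mem_nodes] at hv
  unfold search at h3
  exact ⟨v, hv, h2, (Option.some.inj h3).symm⟩

/-- With at most one root there is one first fetch, one visit and one further fetch that finds
nothing: three times `c.total` besides the continuation. -/
theorem search_root_cons_time_le {i B : ℕ} {p : List PlanOp} (hG : OneRoot G)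
    (hB : ∀ v ∈ G.nodes, G.isRoot v = true → r.NodeOK G i v →
      (search c r G E p ⟨[(i, v)], []⟩).2 ≤ B) :
    (search c r G E (.root i :: p) PMatch.empty).2 ≤ 3 * c.total + B := by
  have h := scanAll_time_le (first := c.firstHostRootNode) (next := c.nextHostRootNode)
    (l := E.roots) (f := visitNode c r G (search c r G E p) PMatch.empty i) (B := c.total + B)
    fun a ha => visitNode_time_le (B := B) fun hok =>
      hB a ((E.mem_roots a).1 ha).1 ((E.mem_roots a).1 ha).2 hok
  have hl := Nat.mul_le_mul_right (c.total + B + c.nextHostRootNode) (E.length_roots_le_one hG)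
  have h1 : c.firstHostRootNode ≤ c.total := by unfold OpCosts.total; omega
  have h2 : c.nextHostRootNode ≤ c.total := by unfold OpCosts.total; omega
  unfold search
  omega

theorem search_root_cons_eq_some {i : ℕ} {p : List PlanOp}
    (h : (search c r G E (.root i :: p) PMatch.empty).1 = some m) :
    ∃ v ∈ G.nodes, G.isRoot v = true ∧ r.NodeOK G i v ∧
      (search c r G E p ⟨[(i, v)], []⟩).1 = some m := by
  unfold search at h
  obtain ⟨v, hv, hm⟩ := exists_of_scanAll_eq_some h
  obtain ⟨-, h2, h3⟩ := visitNode_eq_some hm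
  rw [E.mem_roots] at hv
  exact ⟨v, hv.1, hv.2, h2, h3⟩

theorem initRule_plan : initRule.plan = [.node 0] := rfl

theorem matchRule_plan : matchRule.plan = [.node 0] := rfl

theorem verifyRule_plan : verifyRule.plan = [.root 0] := rfl

/-- The root on the left-hand side is the target of the edge, so the edge is followed backwards and
the degrees of the node to be deleted are tested first. -/
theorem pruneRule_plan : pruneRule.plan = [.root 1, .inEdge 0] := rfl

theorem pushRule_plan : pushRule.plan = [.root 0, .outEdge 0] := rfl

theorem loopRule_plan : loopRule.plan = [.root 0, .outEdge 0] := rfl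

theorem verify_time_le (hG : OneRoot G) :
    (search c verifyRule G E verifyRule.plan PMatch.empty).2 ≤ 3 * c.total := by
  rw [verifyRule_plan]
  exact search_root_cons_time_le E (B := 0) hG fun _ _ _ _ => le_rfl

theorem verify_eq_some (h : (search c verifyRule G E verifyRule.plan PMatch.empty).1 = some m) :
    ∃ v ∈ G.nodes, G.isRoot v = true ∧ G.nodeMark v = .blue ∧ G.indeg v < 2 ∧
      m = ⟨[(0, v)], []⟩ := by
  rw [verifyRule_plan] at h
  obtain ⟨v, hv, hr, hok, hm⟩ := search_root_cons_eq_some E h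
  unfold search at hm
  simp [Rule.NodeOK, verifyRule, DegCond.Holds] at hok
  exact ⟨v, hv, hr, hok.1, Nat.lt_succ_of_le hok.2.2.1, (Option.some.inj hm).symm⟩

theorem search_outEdge (e v : ℕ) (le : LeftEdge) (hle : r.leftEdges[e]? = some le)
    (hm : m.node? le.src = some v) :
    search c r G E [.outEdge e] m = scanAll c.firstOutEdge c.nextOutEdge
      (fun h => visitEdge c r G (search c r G E []) m e le.mark le.tgt h (G.tgt h))
      (E.outEdges v) := by
  rw [search, hle]
  dsimp only
  rw [hm]

theorem search_inEdge (e v : ℕ) (le : LeftEdge) (hle : r.leftEdges[e]? = some le)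
    (hm : m.node? le.tgt = some v) :
    search c r G E [.inEdge e] m = scanAll c.firstInEdge c.nextInEdge
      (fun h => visitEdge c r G (search c r G E []) m e le.mark le.src h (G.src h))
      (E.inEdges v) := by
  rw [search, hle]
  dsimp only
  rw [hm]

theorem prune_time_le (hG : OneRoot G) :
    (search c pruneRule G E pruneRule.plan PMatch.empty).2 ≤ 7 * c.total := by
  rw [pruneRule_plan]
  have key := search_root_cons_time_le (c := c) E (r := pruneRule) (i := 1) (B := 4 * c.total)
    (p := [.inEdge 0]) hG fun v _ _ hok => by
      rw [search_inEdge E 0 v ⟨0, 1, .unmarked⟩ rfl rfl]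
      -- The dangling condition: a root that passes has a single incoming edge, so the scan has one
      -- candidate.
      have hd : G.indeg v = 1 := by
        simp [Rule.NodeOK, pruneRule, Rule.leftIndeg] at hok
        exact hok.2.2.1
      have h := scanAll_time_le (first := c.firstInEdge) (next := c.nextInEdge)
        (l := E.inEdges v) (B := c.total + (c.total + 0))
        (f := fun h => visitEdge c pruneRule G (search c pruneRule G E []) ⟨[(1, v)], []⟩ 0
          .unmarked 0 h (G.src h)) fun a _ => visitEdge_time_le fun _ => le_rfl
      rw [E.length_inEdges, hd] at h
      have h1 : c.firstInEdge ≤ c.total := by unfold OpCosts.total; omega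
      have h2 : c.nextInEdge ≤ c.total := by unfold OpCosts.total; omega
      dsimp only at h ⊢
      omega
  omega

theorem prune_eq_some (h : (search c pruneRule G E pruneRule.plan PMatch.empty).1 = some m) :
    ∃ e ∈ G.edges, G.isRoot (G.tgt e) = true ∧ G.indeg (G.tgt e) = 1 ∧ G.outdeg (G.tgt e) = 0 ∧
      m = ⟨[(0, G.src e), (1, G.tgt e)], [(0, e)]⟩ := by
  rw [pruneRule_plan] at h
  obtain ⟨v, hv, hr, hok, hm⟩ := search_root_cons_eq_some E h
  rw [search_inEdge E 0 v ⟨0, 1, .unmarked⟩ rfl rfl] at hm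
  obtain ⟨e, he, hm⟩ := exists_of_scanAll_eq_some hm
  obtain ⟨-, -, hm⟩ := visitEdge_eq_some hm
  rw [visitEndpoint_of_none rfl] at hm
  obtain ⟨-, -, hm⟩ := visitNode_eq_some hm
  unfold search at hm
  obtain ⟨heG, rfl⟩ := (E.mem_inEdges v e).1 he
  simp [Rule.NodeOK, pruneRule, Rule.leftIndeg, Rule.leftOutdeg] at hok
  exact ⟨e, heG, hr, hok.2.2.1, hok.2.2.2, (Option.some.inj hm).symm⟩

/-- Under `hout` every edge leaving the root completes a match, so only the first one is examined.
-/
theorem push_time_le (hG : OneRoot G)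
    (hout : ∀ e ∈ G.edges, G.isRoot (G.src e) = true → G.edgeMark e = .unmarked ∧
      G.nodeMark (G.tgt e) = .grey ∧ G.isRoot (G.tgt e) = false) :
    (search c pushRule G E pushRule.plan PMatch.empty).2 ≤ 6 * c.total := by
  rw [pushRule_plan]
  have key := search_root_cons_time_le (c := c) E (r := pushRule) (i := 0) (B := 3 * c.total)
    (p := [.outEdge 0]) hG fun v _ hr _ => by
      rw [search_outEdge E 0 v ⟨0, 1, .unmarked⟩ rfl rfl]
      have h := scanAll_time_le_of_isSome (first := c.firstOutEdge) (next := c.nextOutEdge)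
        (l := E.outEdges v) (B := c.total + (c.total + 0))
        (f := fun h => visitEdge c pushRule G (search c pushRule G E []) ⟨[(0, v)], []⟩ 0
          .unmarked 1 h (G.tgt h)) fun e he => by
            refine ⟨?_, visitEdge_time_le fun _ => le_rfl⟩
            obtain ⟨heG, rfl⟩ := (E.mem_outEdges v e).1 he
            obtain ⟨h1, h2, h3⟩ := hout e heG hr
            refine visitEdge_isSome (by simp [PMatch.EdgeUsed]) h1 ?_
            rw [visitEndpoint_of_none rfl]
            refine visitNode_isSome ?_ ?_ rfl
            · simp only [PMatch.NodeUsed, PMatch.addEdge, List.map_cons, List.map_nil,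
                List.mem_singleton]
              intro heq
              rw [heq, hr] at h3
              exact absurd h3 (by simp)
            -- The tests on a preserved node require at least its left-hand indegree, here 1; `e`
            -- provides it.
            · have : 0 < G.indeg (G.tgt e) :=
                Finset.card_pos.2 ⟨e, Finset.mem_filter.2 ⟨heG, rfl⟩⟩
              simp [Rule.NodeOK, pushRule, Rule.leftIndeg, Rule.leftOutdeg, h2, h3]
              omega
      have h1 : c.firstOutEdge ≤ c.total := by unfold OpCosts.total; omega
      dsimp only at h ⊢
      omega
  omega

theorem push_eq_some (h : (search c pushRule G E pushRule.plan PMatch.empty).1 = some m) :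
    ∃ e ∈ G.edges, G.isRoot (G.src e) = true ∧ G.nodeMark (G.tgt e) = .grey ∧
      m = ⟨[(1, G.tgt e), (0, G.src e)], [(0, e)]⟩ := by
  rw [pushRule_plan] at h
  obtain ⟨v, hv, hr, hok, hm⟩ := search_root_cons_eq_some E h
  rw [search_outEdge E 0 v ⟨0, 1, .unmarked⟩ rfl rfl] at hm
  obtain ⟨e, he, hm⟩ := exists_of_scanAll_eq_some hm
  obtain ⟨-, -, hm⟩ := visitEdge_eq_some hm
  rw [visitEndpoint_of_none rfl] at hm
  obtain ⟨-, hok', hm⟩ := visitNode_eq_some hm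
  unfold search at hm
  obtain ⟨heG, rfl⟩ := (E.mem_outEdges v e).1 he
  simp [Rule.NodeOK, pushRule, Rule.leftIndeg, Rule.leftOutdeg] at hok'
  exact ⟨e, heG, hr, hok'.1, (Option.some.inj hm).symm⟩

theorem loop_time_le (hG : OneRoot G) :
    (search c loopRule G E loopRule.plan PMatch.empty).2 ≤
      c.total * (3 * G.edges.card + 4) := by
  rw [loopRule_plan]
  have key := search_root_cons_time_le (c := c) E (r := loopRule) (i := 0)
    (B := c.total + G.edges.card * (3 * c.total))
    (p := [.outEdge 0]) hG fun v _ _ _ => by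
      rw [search_outEdge E 0 v ⟨0, 0, .unmarked⟩ rfl rfl]
      have h := scanAll_time_le (first := c.firstOutEdge) (next := c.nextOutEdge)
        (l := E.outEdges v) (B := c.total + (c.total + 0))
        (f := fun h => visitEdge c loopRule G (search c loopRule G E []) ⟨[(0, v)], []⟩ 0
          .unmarked 0 h (G.tgt h)) fun a _ => visitEdge_time_le fun _ => le_rfl
      rw [E.length_outEdges] at h
      have h1 : c.firstOutEdge ≤ c.total := by unfold OpCosts.total; omega
      have h2 : c.nextOutEdge ≤ c.total := by unfold OpCosts.total; omega
      refine h.trans (Nat.add_le_add h1 (Nat.mul_le_mul (G.outdeg_le_card v) (by omega)))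
  linarith

theorem loop_eq_some (h : (search c loopRule G E loopRule.plan PMatch.empty).1 = some m) :
    ∃ v e, m = ⟨[(0, v)], [(0, e)]⟩ := by
  rw [loopRule_plan] at h
  obtain ⟨v, -, -, -, hm⟩ := search_root_cons_eq_some E h
  rw [search_outEdge E 0 v ⟨0, 0, .unmarked⟩ rfl rfl] at hm
  obtain ⟨e, -, hm⟩ := exists_of_scanAll_eq_some hm
  obtain ⟨-, -, hm⟩ := visitEdge_eq_some hm
  obtain ⟨-, hm⟩ := visitEndpoint_eq_some_of_some (v := v) rfl hm
  unfold search at hm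
  exact ⟨v, e, (Option.some.inj hm).symm⟩

end IsTree

/-! ## Depth-first search -/

namespace IsTree

/-- The state of the depth-first search: `l` lists the nodes of the current path from its end, which
is the root, back to its start. These are the blue nodes; an edge can enter the path only from
the preceding node of the path. -/
structure IsDFS (G : HostGraph) (l : List ℕ) : Prop where
  wf : G.WF
  unmarked : ∀ e ∈ G.edges, G.edgeMark e = .unmarked
  path : ∀ e ∈ G.edges, G.tgt e ∈ l → [G.tgt e, G.src e] <:+: l
  nodup : l.Nodup
  subset : ∀ v ∈ l, v ∈ G.nodes
  blue : ∀ v ∈ l, G.nodeMark v = .blue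
  grey : ∀ v ∈ G.nodes, v ∉ l → G.nodeMark v = .grey
  root : ∀ v ∈ G.nodes, G.isRoot v = true ↔ l.head? = some v

variable {G : HostGraph} {l : List ℕ}

namespace IsDFS

theorem oneRoot (h : IsDFS G l) : OneRoot G := by
  intro v hv w hw hv' hw'
  have := ((h.root v hv).1 hv').symm.trans ((h.root w hw).1 hw')
  exact Option.some.inj this

theorem exists_cons (h : IsDFS G l) {v : ℕ} (hv : v ∈ G.nodes) (hr : G.isRoot v = true) :
    ∃ l', l = v :: l' := by
  have := (h.root v hv).1 hr
  cases l with
  | nil => simp at this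
  | cons a l => exact ⟨l, by simpa using this⟩

theorem length_le (h : IsDFS G l) : l.length ≤ G.nodes.card := by
  rw [← List.toFinset_card_of_nodup h.nodup]
  exact Finset.card_le_card fun v hv => h.subset v (List.mem_toFinset.1 hv)

/-- No edge from the root leads to a blue node. -/
theorem tgt_notMem (h : IsDFS G l) {e : ℕ} (he : e ∈ G.edges) (hr : G.isRoot (G.src e) = true) :
    G.tgt e ∉ l := by
  intro hl
  obtain ⟨l', rfl⟩ := h.exists_cons (h.wf e he).1 hr
  -- Otherwise the root would directly follow some entry of the path. It would then occur in the
  -- tail as well as at the head, against `nodup`.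
  obtain ⟨s, t, hst⟩ := h.path e he hl
  have hn := h.nodup
  rw [List.nodup_cons] at hn
  cases s with
  | nil =>
    simp only [List.nil_append, List.cons_append, List.cons.injEq] at hst
    exact hn.1 (by rw [← hst.2]; simp)
  | cons a s =>
    simp only [List.cons_append, List.cons.injEq] at hst
    exact hn.1 (by rw [← hst.2]; simp)

/-- This supplies the hypothesis `hout` of `push_time_le`. -/
theorem out_of_root (h : IsDFS G l) {e : ℕ} (he : e ∈ G.edges) (hr : G.isRoot (G.src e) = true) :
    G.edgeMark e = .unmarked ∧ G.nodeMark (G.tgt e) = .grey ∧ G.isRoot (G.tgt e) = false := by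
  have hl := h.tgt_notMem he hr
  refine ⟨h.unmarked e he, h.grey _ (h.wf e he).2 hl, ?_⟩
  by_contra hc
  obtain ⟨l', rfl⟩ := h.exists_cons (h.wf e he).2 (by simpa using hc)
  simp at hl

end IsDFS

/-- The graph that results from an application of `init`. -/
theorem isDFS_init (hG : G.IsInputGraph) {v : ℕ} (hv : v ∈ G.nodes) (hd : G.indeg v = 0) :
    IsDFS (initRule.apply ⟨[(0, v)], []⟩ G) [v] := by
  -- No edge enters the start of the path, so the path condition holds vacuously.
  have hi : ∀ e ∈ G.edges, G.tgt e ≠ v := by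
    unfold HostGraph.indeg at hd
    simpa [Finset.filter_eq_empty_iff] using hd
  simp only [Rule.apply, Rule.updates, initRule, Rule.nodeUpdate, HostGraph.update, List.map_nil,
    List.map_cons, List.nil_append, List.append_nil, List.foldl_cons, List.foldl_nil,
    List.getElem?_cons_zero, Option.bind_some]
  refine ⟨hG.wf, hG.unmarked, ?_, by simp, by simpa using hv, by simp, ?_, ?_⟩
  · intro e he ht
    exact absurd (by simpa using ht) (hi e he)
  · intro w hw hwv
    have : w ≠ v := by simpa using hwv
    simpa [Function.update_of_ne this] using hG.grey w hw
  · intro w hw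
    by_cases hwv : w = v
    · simp [hwv]
    · simp [Function.update_of_ne hwv, hG.unrooted w hw, Ne.symm hwv]

theorem apply_verify {v : ℕ} (hb : G.nodeMark v = .blue) (hr : G.isRoot v = true) :
    verifyRule.apply ⟨[(0, v)], []⟩ G = G := by
  have h1 : Function.update G.nodeMark v .blue = G.nodeMark := by rw [← hb]; simp
  have h2 : Function.update G.isRoot v true = G.isRoot := by rw [← hr]; simp
  simp [Rule.apply, Rule.updates, verifyRule, Rule.nodeUpdate, HostGraph.update, h1, h2]

/-- The graph that results from an application of `prune` to the edge `e`. -/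
theorem isDFS_prune (h : IsDFS G l) {e : ℕ} (he : e ∈ G.edges) (hr : G.isRoot (G.tgt e) = true)
    (hi : G.indeg (G.tgt e) = 1) (ho : G.outdeg (G.tgt e) = 0) :
    IsDFS (pruneRule.apply ⟨[(0, G.src e), (1, G.tgt e)], [(0, e)]⟩ G) l.tail := by
  obtain ⟨l', rfl⟩ := h.exists_cons (h.wf e he).2 hr
  have hn := List.nodup_cons.1 h.nodup
  have hsrc : ∀ e' ∈ G.edges, G.src e' ≠ G.tgt e := by
    unfold HostGraph.outdeg at ho
    simpa [Finset.filter_eq_empty_iff] using ho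
  -- Indegree 1 makes `e` the only edge into the deleted node; with `hsrc`, no edge is left
  -- dangling.
  have htgt : ∀ e' ∈ G.edges.erase e, G.tgt e' ≠ G.tgt e := by
    intro e' he' heq
    obtain ⟨a, ha⟩ := Finset.card_eq_one.1 hi
    have h1 : e ∈ ({a} : Finset ℕ) := ha ▸ Finset.mem_filter.2 ⟨he, rfl⟩
    have h2 : e' ∈ ({a} : Finset ℕ) :=
      ha ▸ Finset.mem_filter.2 ⟨Finset.mem_of_mem_erase he', heq⟩
    rw [Finset.mem_singleton] at h1 h2
    exact Finset.ne_of_mem_erase he' (h2.trans h1.symm)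
  have hpath : ∀ e' ∈ G.edges, G.tgt e' ≠ G.tgt e → G.tgt e' ∈ l' →
      [G.tgt e', G.src e'] <:+: l' := by
    intro e' he' hne hl'
    rcases List.infix_cons_iff.1 (h.path e' he' (List.mem_cons_of_mem _ hl')) with hp | hp
    · rw [List.cons_prefix_cons] at hp
      exact absurd hp.1 hne
    · exact hp
  -- The path condition for `e` itself shows that its source comes next on the path, so the new root
  -- is the new head.
  have hhead : ∃ l'', l' = G.src e :: l'' := by
    rcases List.infix_cons_iff.1 (h.path e he List.mem_cons_self) with hp | hp
    · rw [List.cons_prefix_cons] at hp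
      obtain ⟨t, ht⟩ := hp.2
      exact ⟨t, by simpa using ht.symm⟩
    · exact absurd (hp.subset List.mem_cons_self) hn.1
  simp only [Rule.apply, Rule.updates, pruneRule, Rule.nodeUpdate, HostGraph.update, List.map_nil,
    List.map_cons, List.nil_append, List.cons_append, List.append_nil, List.foldl_cons,
    List.foldl_nil, List.getElem?_cons_zero, List.getElem?_cons_succ, Option.bind_some,
    List.tail_cons]
  have hmem : ∀ v ∈ l', v ≠ G.tgt e := fun v hv hvt => hn.1 (hvt ▸ hv)
  refine ⟨?_, ?_, ?_, hn.2, ?_, ?_, ?_, ?_⟩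
  · intro e' he'
    dsimp only at he' ⊢
    have he'' := Finset.mem_of_mem_erase he'
    exact ⟨Finset.mem_erase.2 ⟨hsrc e' he'', (h.wf e' he'').1⟩,
      Finset.mem_erase.2 ⟨htgt e' he', (h.wf e' he'').2⟩⟩
  · exact fun e' he' => h.unmarked e' (Finset.mem_of_mem_erase he')
  · exact fun e' he' => hpath e' (Finset.mem_of_mem_erase he') (htgt e' he')
  · exact fun v hv => Finset.mem_erase.2 ⟨hmem v hv, h.subset v (List.mem_cons_of_mem _ hv)⟩
  · intro v hv
    have := h.blue v (List.mem_cons_of_mem _ hv)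
    simp [Function.update_apply, this]
  · intro v hv hvl
    obtain ⟨hvt, hv⟩ := Finset.mem_erase.1 hv
    have hvs : v ≠ G.src e := by
      obtain ⟨l'', rfl⟩ := hhead
      rintro rfl
      simp at hvl
    have := h.grey v hv (by simp [hvt, hvl])
    simpa [Function.update_of_ne hvs] using this
  · intro v hv
    obtain ⟨hvt, hv⟩ := Finset.mem_erase.1 hv
    obtain ⟨l'', rfl⟩ := hhead
    by_cases hvs : v = G.src e
    · simp [hvs]
    · have := h.root v hv
      simp only [List.head?_cons, Option.some.injEq] at this ⊢
      rw [Function.update_of_ne hvs, this]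
      exact ⟨fun hh => absurd hh.symm hvt, fun hh => absurd hh.symm hvs⟩

theorem card_nodes_prune {e : ℕ} (h : G.tgt e ∈ G.nodes) :
    (pruneRule.apply ⟨[(0, G.src e), (1, G.tgt e)], [(0, e)]⟩ G).nodes.card + 1 =
      G.nodes.card :=
  Finset.card_erase_add_one h

theorem card_edges_prune {e : ℕ} :
    (pruneRule.apply ⟨[(0, G.src e), (1, G.tgt e)], [(0, e)]⟩ G).edges.card ≤ G.edges.card :=
  Finset.card_erase_le

theorem freshEdge_notMem (G : HostGraph) : G.freshEdge ∉ G.edges := by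
  intro h
  have : G.freshEdge ≤ G.edges.sup id := Finset.le_sup (f := id) h
  unfold HostGraph.freshEdge at this
  omega

/-- The graph that results from an application of `push` to the edge `e`, spelled out. -/
theorem exists_apply_push {e : ℕ} :
    ∃ f lab, f ∉ G.edges.erase e ∧
      pushRule.apply ⟨[(1, G.tgt e), (0, G.src e)], [(0, e)]⟩ G =
        { nodes := G.nodes
          edges := insert f (G.edges.erase e)
          src := Function.update G.src f (G.src e)
          tgt := Function.update G.tgt f (G.tgt e)
          nodeLabel := G.nodeLabel
          nodeMark := Function.update (Function.update G.nodeMark (G.tgt e) .blue) (G.src e) .blue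
          isRoot := Function.update (Function.update G.isRoot (G.tgt e) true) (G.src e) false
          edgeLabel := Function.update G.edgeLabel f lab
          edgeMark := Function.update G.edgeMark f .unmarked } :=
  -- The name is chosen after `e` has been deleted and may be `e` again, so it is fresh only for the
  -- remaining edges.
  ⟨_, _, freshEdge_notMem (G.update (.deleteEdge e)), rfl⟩

theorem card_nodes_push {e : ℕ} :
    (pushRule.apply ⟨[(1, G.tgt e), (0, G.src e)], [(0, e)]⟩ G).nodes.card = G.nodes.card :=
  rfl

theorem card_edges_push {e : ℕ} (he : e ∈ G.edges) :
    (pushRule.apply ⟨[(1, G.tgt e), (0, G.src e)], [(0, e)]⟩ G).edges.card = G.edges.card := by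
  obtain ⟨f, lab, hf, heq⟩ := exists_apply_push (G := G) (e := e)
  rw [heq, Finset.card_insert_of_notMem hf, Finset.card_erase_add_one he]

theorem eq_tgt_of_isRoot_push (h : IsDFS G l) {e v : ℕ} (he : e ∈ G.edges)
    (hr : G.isRoot (G.src e) = true) (hv : v ∈ G.nodes)
    (hvr : (pushRule.apply ⟨[(1, G.tgt e), (0, G.src e)], [(0, e)]⟩ G).isRoot v = true) :
    v = G.tgt e := by
  obtain ⟨f, lab, hf, heq⟩ := exists_apply_push (G := G) (e := e)
  rw [heq] at hvr
  dsimp only at hvr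
  by_cases h1 : v = G.src e
  · simp [h1] at hvr
  · rw [Function.update_of_ne h1] at hvr
    by_contra h2
    rw [Function.update_of_ne h2] at hvr
    exact h1 (h.oneRoot v hv _ (h.wf e he).1 hvr hr)

/-- Before `verify` has succeeded other edges may enter the new root, so `IsDFS` may fail; a single
root is all that the search of `verify` needs. -/
theorem oneRoot_push (h : IsDFS G l) {e : ℕ} (he : e ∈ G.edges)
    (hr : G.isRoot (G.src e) = true) :
    OneRoot (pushRule.apply ⟨[(1, G.tgt e), (0, G.src e)], [(0, e)]⟩ G) :=
  fun _ hv _ hw hv' hw' =>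
    (eq_tgt_of_isRoot_push h he hr hv hv').trans (eq_tgt_of_isRoot_push h he hr hw hw').symm

/-- The hypothesis `hi` is the test of `verify`. It leaves the reinserted edge as the only one into
the new head, and that edge comes from the old head; the condition on the older path nodes is
inherited. -/
theorem isDFS_push (h : IsDFS G l) {e : ℕ} (he : e ∈ G.edges) (hr : G.isRoot (G.src e) = true)
    (hi : (pushRule.apply ⟨[(1, G.tgt e), (0, G.src e)], [(0, e)]⟩ G).indeg (G.tgt e) < 2) :
    IsDFS (pushRule.apply ⟨[(1, G.tgt e), (0, G.src e)], [(0, e)]⟩ G) (G.tgt e :: l) := by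
  have htl := h.tgt_notMem he hr
  obtain ⟨l', rfl⟩ := h.exists_cons (h.wf e he).1 hr
  have hst : G.tgt e ≠ G.src e := by
    intro hh
    simp [hh] at htl
  obtain ⟨f, lab, hf, heq⟩ := exists_apply_push (G := G) (e := e)
  rw [heq] at hi ⊢
  have htgt : ∀ e' ∈ G.edges.erase e, G.tgt e' ≠ G.tgt e := by
    intro e' he' hh
    have hne : e' ≠ f := fun hc => hf (hc ▸ he')
    -- The reinserted edge `f` already enters the new root, so a second edge would raise the
    -- indegree to 2.
    refine absurd hi (not_lt.2 (Finset.one_lt_card.2 ⟨f, ?_, e', ?_, hne.symm⟩))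
    · simp
    · refine Finset.mem_filter.2 ⟨Finset.mem_insert_of_mem he', ?_⟩
      simpa [Function.update_of_ne hne] using hh
  have hcases : ∀ e' ∈ insert f (G.edges.erase e), e' = f ∨ e' ≠ f ∧ e' ∈ G.edges.erase e := by
    intro e' he'
    rcases Finset.mem_insert.1 he' with rfl | he'
    · exact .inl rfl
    · exact .inr ⟨fun hc => hf (hc ▸ he'), he'⟩
  refine ⟨?_, ?_, ?_, ?_, ?_, ?_, ?_, ?_⟩
  · intro e' he'
    rcases hcases e' he' with rfl | ⟨hne, he'⟩
    · simpa using h.wf e he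
    · simpa [Function.update_of_ne hne] using h.wf e' (Finset.mem_of_mem_erase he')
  · intro e' he'
    rcases hcases e' he' with rfl | ⟨hne, he'⟩
    · simp
    · simpa [Function.update_of_ne hne] using h.unmarked e' (Finset.mem_of_mem_erase he')
  · intro e' he' ht
    rcases hcases e' he' with rfl | ⟨hne, he'⟩
    · simpa using (List.prefix_append [G.tgt e, G.src e] l').isInfix
    · simp only [Function.update_of_ne hne] at ht ⊢
      have ht' := (List.mem_cons.1 ht).resolve_left (htgt e' he')
      exact (h.path e' (Finset.mem_of_mem_erase he') ht').trans (List.suffix_cons _ _).isInfix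
  · exact List.nodup_cons.2 ⟨htl, h.nodup⟩
  · intro v hv
    rcases List.mem_cons.1 hv with rfl | hv
    · exact (h.wf e he).2
    · exact h.subset v hv
  · intro v hv
    simp only [Function.update_apply]
    rcases List.mem_cons.1 hv with rfl | hv
    · simp
    · simp [h.blue v hv]
  · intro v hv hvl
    rw [List.mem_cons, not_or] at hvl
    have hvs : v ≠ G.src e := fun hc => hvl.2 (hc ▸ List.mem_cons_self)
    simpa [Function.update_of_ne hvs, Function.update_of_ne hvl.1] using h.grey v hv hvl.2
  · intro v hv
    rw [List.head?_cons, Option.some.injEq]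
    constructor
    · intro hvr
      exact (eq_tgt_of_isRoot_push h he hr hv (by rw [heq]; exact hvr)).symm
    · rintro rfl
      simp [Function.update_of_ne hst]

end IsTree

/-! ## The running time of `is-tree` -/

namespace IsTree

variable {c : OpCosts} {P : Com} {K : List Frame} {G : HostGraph} {l : List ℕ} {log T : ℕ}

theorem within_prune (h : IsDFS G l)
    (hsucc : ∀ e ∈ G.edges, G.isRoot (G.tgt e) = true → G.indeg (G.tgt e) = 1 →
      G.outdeg (G.tgt e) = 0 → Within c P (.exec .done K
        (pruneRule.apply ⟨[(0, G.src e), (1, G.tgt e)], [(0, e)]⟩ G) (log + 3)) T)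
    (hfail : Within c P (.exec .failed K G log) T) :
    Within c P (.exec (.run (.call [pruneRule])) K G log) (11 * c.total + T) := by
  -- One edge and two nodes are matched and modified. The search costs 7, the rest of the call `n +
  -- 1 = 4`.
  refine (Within.call (B := 7 * c.total) (n := 3) (T := T) ?_ ?_ hfail).mono ?_
  · intro E r hr
    rw [List.mem_singleton] at hr
    subst hr
    exact prune_time_le E h.oneRoot
  · intro E r hr m hm
    rw [List.mem_singleton] at hr
    subst hr
    obtain ⟨e, he, h1, h2, h3, rfl⟩ := prune_eq_some E hm
    exact ⟨le_rfl, le_rfl, hsucc e he h1 h2 h3⟩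
  · rw [List.length_singleton]
    omega

theorem within_push (h : IsDFS G l)
    (hsucc : ∀ e ∈ G.edges, G.isRoot (G.src e) = true → Within c P (.exec .done K
      (pushRule.apply ⟨[(1, G.tgt e), (0, G.src e)], [(0, e)]⟩ G) (log + 4)) T)
    (hfail : Within c P (.exec .failed K G log) T) :
    Within c P (.exec (.run (.call [pushRule])) K G log) (11 * c.total + T) := by
  -- Three items are matched, but the edge is deleted and inserted again, which makes four
  -- modifications.
  refine (Within.call (B := 6 * c.total) (n := 4) (T := T) ?_ ?_ hfail).mono ?_
  · intro E r hr
    rw [List.mem_singleton] at hr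
    subst hr
    exact push_time_le E h.oneRoot fun e he hr => h.out_of_root he hr
  · intro E r hr m hm
    rw [List.mem_singleton] at hr
    subst hr
    obtain ⟨e, he, h1, -, rfl⟩ := push_eq_some E hm
    exact ⟨by simp, le_rfl, hsucc e he h1⟩
  · rw [List.length_singleton]
    omega

theorem within_verify (h : OneRoot G)
    (hsucc : ∀ v ∈ G.nodes, G.isRoot v = true → G.indeg v < 2 →
      Within c P (.exec .done K G (log + 1)) T)
    (hfail : Within c P (.exec .failed K G log) T) :
    Within c P (.exec (.run (.call [verifyRule])) K G log) (5 * c.total + T) := by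
  refine (Within.call (B := 3 * c.total) (n := 1) (T := T) ?_ ?_ hfail).mono ?_
  · intro E r hr
    rw [List.mem_singleton] at hr
    subst hr
    exact verify_time_le E h
  · intro E r hr m hm
    rw [List.mem_singleton] at hr
    subst hr
    obtain ⟨v, hv, h1, h2, h3, rfl⟩ := verify_eq_some E hm
    refine ⟨le_rfl, le_rfl, ?_⟩
    rw [apply_verify h2 h1]
    exact hsucc v hv h1 h3
  · rw [List.length_singleton]
    omega

theorem within_init (hsucc : ∀ v ∈ G.nodes, G.indeg v = 0 → Within c P (.exec .done K
      (initRule.apply ⟨[(0, v)], []⟩ G) (log + 1)) T)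
    (hfail : Within c P (.exec .failed K G log) T) :
    Within c P (.exec (.run (.call [initRule])) K G log)
      (c.total * (2 * G.nodes.card + 3) + T) := by
  refine (Within.call (B := c.total * (2 * G.nodes.card + 1)) (n := 1) (T := T)
    ?_ ?_ hfail).mono ?_
  · intro E r hr
    rw [List.mem_singleton] at hr
    subst hr
    exact search_node_time_le E
  · intro E r hr m hm
    rw [List.mem_singleton] at hr
    subst hr
    rw [initRule_plan] at hm
    obtain ⟨v, hv, hok, rfl⟩ := search_node_eq_some E hm
    simp [Rule.NodeOK, initRule, DegCond.Holds] at hok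
    exact ⟨le_rfl, le_rfl, hsucc v hv hok.2.2.1⟩
  · rw [List.length_singleton]
    linarith

/-- The loop `Reduce!`. The number `2 * |V| - |l|` decreases in each iteration, and each iteration
takes constant time. -/
theorem within_reduce {N M p : ℕ} (h : IsDFS G l) (hp : 2 * G.nodes.card ≤ p + l.length)
    (hN : G.nodes.card ≤ N) (hM : G.edges.card ≤ M)
    (hT : ∀ G' l' log', IsDFS G' l' → G'.nodes.card ≤ N → G'.edges.card ≤ M →
      Within c P (.exec .done K G' log') T) :
    Within c P (.exec (.run (.alap reduce)) K G log) (c.total * (40 * (p + 1)) + T) := by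
  induction p using Nat.strong_induction_on generalizing G l log with
  | _ p ih =>
  have hlen := h.length_le
  have hnext : 0 < p → ∀ G' l' log', IsDFS G' l' → 2 * G'.nodes.card + 1 ≤ p + l'.length →
      G'.nodes.card ≤ N → G'.edges.card ≤ M →
      Within c P (.exec (.run (.alap reduce)) K G' log') (c.total * (40 * p) + T) := by
    intro hpos G' l' log' h' hp' hN' hM'
    obtain ⟨q, rfl⟩ : ∃ q, p = q + 1 := ⟨p - 1, by omega⟩
    exact ih q (by omega) h' (by omega) hN' hM'
  -- If `push` or `verify` fails, the loop frame restores this very `G`, so the loop is always left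
  -- in a graph satisfying the invariant.
  have hdone := hT G l log h hN hM
  -- The 40 per iteration is 1 for entering the loop, 1 for `try`, 11 for `prune` and 27 for the
  -- rest. The 27 is 1 for leaving `try`, 1 for the sequence, 11 for `push` and 14 for what follows
  -- it.
  refine (Within.alapEnter (Within.tryEnter (within_prune h (T := 27 * c.total +
    (c.total * (40 * p) + T)) ?_ ?_))).mono (by linarith)
  · intro e he hr hi ho
    have hmem := (h.wf e he).2
    have hV := card_nodes_prune hmem
    have hE := card_edges_prune (G := G) (e := e)
    obtain ⟨l', rfl⟩ := h.exists_cons hmem hr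
    rw [List.length_cons] at hp hlen
    refine (Within.tryDone (Within.skip (Within.alapDone (hnext (by omega) _ l' _
      (isDFS_prune h he hr hi ho) ?_ ?_ ?_)))).mono (by omega)
    · omega
    · omega
    · omega
  · refine (Within.tryFailed (Within.seqEnter (within_push h (T := 14 * c.total +
      (c.total * (40 * p) + T)) ?_ ?_))).mono (by rw [Nat.sub_self]; omega)
    · intro e he hr
      have hE := card_edges_push he
      have hlen' : 0 < p := by
        have := Finset.card_pos.2 ⟨_, (h.wf e he).2⟩
        omega
      refine (Within.seqDone (within_verify (T := 6 * c.total + (c.total * (40 * p) + T))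
        (oneRoot_push h he hr) ?_ ?_)).mono (by omega)
      · intro v hv hvr hi
        rw [eq_tgt_of_isRoot_push h he hr hv hvr] at hi
        refine (Within.alapDone (hnext hlen' _ _ _ (isDFS_push h he hr hi) ?_ ?_ ?_)).mono
          (by omega)
        · rw [card_nodes_push, List.length_cons]
          omega
        · exact hN
        · omega
      -- The four modifications made by `push` are revoked.
      · refine (Within.alapFailed hdone).mono ?_
        rw [Nat.add_sub_cancel_left]
        omega
    · refine (Within.seqFailed (Within.alapFailed hdone)).mono ?_
      rw [Nat.sub_self]
      omega

theorem within_check (h : OneRoot G) :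
    Within c P (.exec (.run check) [] G log)
      (c.total * (7 * (G.nodes.card + G.edges.card) + 30)) := by
  refine (Within.ifEnter (Within.call (B := c.total * (3 * (G.nodes.card + G.edges.card) + 4))
    (n := 3) (T := 6 * c.total + c.total * (G.nodes.card + G.edges.card + 1)) ?_ ?_ ?_)).mono ?_
  · intro E r hr
    rcases List.mem_pair.1 hr with rfl | rfl
    · rw [matchRule_plan]
      exact (search_node_time_le E).trans (Nat.mul_le_mul_left _ (by omega))
    · exact (loop_time_le E h).trans (Nat.mul_le_mul_left _ (by omega))
  · intro E r hr m hm
    -- After a match, at most three modifications are revoked before `fail` and the abort: 4 + 1 + 1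
    -- = 6.
    have hfinal : ∀ G' n, n ≤ 3 → Within c P
        (.exec .done [.ifThenElse G log .fail .skip] G' (log + n))
        (6 * c.total + c.total * (G.nodes.card + G.edges.card + 1)) := by
      intro G' n hn
      refine (Within.ifDone (Within.fail Within.abort)).mono ?_
      have := Nat.mul_le_mul_left c.total (Nat.add_le_add_right hn 1)
      rw [Nat.add_sub_cancel_left]
      omega
    rcases List.mem_pair.1 hr with rfl | rfl
    · rw [matchRule_plan] at hm
      obtain ⟨v, -, -, rfl⟩ := search_node_eq_some E hm
      exact ⟨by simp, by simp [Rule.updates, matchRule],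
        hfinal _ _ (by simp [Rule.updates, matchRule])⟩
    · obtain ⟨v, e, rfl⟩ := loop_eq_some E hm
      exact ⟨by simp, le_rfl, hfinal _ _ le_rfl⟩
  · refine (Within.ifFailed (Within.skip Within.output)).mono ?_
    rw [Nat.sub_self, HostGraph.size]
    omega
  · simp only [List.length_cons, List.length_nil]
    linarith

theorem within_main (hG : G.IsInputGraph) :
    Within c main (.load G) (c.total * 200 * (G.size + 1)) := by
  have hcheck : ∀ G' l' log', IsDFS G' l' → G'.nodes.card ≤ G.nodes.card →
      G'.edges.card ≤ G.edges.card → Within c main (.exec .done [.seq check] G' log')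
        (c.total + c.total * (7 * (G.nodes.card + G.edges.card) + 30)) := by
    intro G' l' log' h' hV hE
    exact (Within.seqDone (within_check h'.oneRoot)).mono
      (Nat.add_le_add_left (Nat.mul_le_mul_left _ (by omega)) _)
  refine (Within.load (Within.seqEnter (within_init (T := 3 * c.total +
    (c.total * (40 * (2 * G.nodes.card + 1)) +
      (c.total + c.total * (7 * (G.nodes.card + G.edges.card) + 30)))) ?_ ?_))).mono ?_
  · intro v hv hd
    -- The path has length 1, so the potential is below this `p` by one; the slack avoids a
    -- subtraction.
    refine (Within.seqDone (Within.seqEnter (within_reduce (p := 2 * G.nodes.card)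
      (isDFS_init hG hv hd) (Nat.le_add_right _ _) le_rfl le_rfl hcheck))).mono ?_
    omega
  · refine (Within.seqFailed Within.abort).mono ?_
    omega
  -- The contributions add up to less than `90 * size + 80` times `c.total`; 200 is a generous round
  -- constant.
  · rw [HostGraph.size, mul_assoc]
    nlinarith [Nat.zero_le (c.total * G.nodes.card), Nat.zero_le (c.total * G.edges.card)]

end IsTree

theorem mainTheorem4 (c : OpCosts) :
    ∃ K : ℕ, ∀ G : HostGraph, G.IsInputGraph →
      TerminatesWithin c IsTree.main G (K * (G.size + 1)) :=
  ⟨c.total * 200, fun _ hG => (IsTree.within_main hG).terminatesWithin⟩
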